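/- A (one-dimensional) stochastic cellular automaton (CA) $\mathcal A=(Q,R,V,V',f)$ consists of non-empty finite sets $Q$ (states) and $R$ (random symbols), finite sets $V,V'\subset\mathbb Z$, and a local function $f:Q^{V}\times R^{V'}\to Q$. Its explicit global function $F:Q^{\mathbb Z}\times R^{\mathbb Z}\to Q^{\mathbb Z}$ is $F(c,s)_z=f\big((c_{z+v})_{v\in V},(s_{z+v'})_{v'\in V'}\big)$, with iterates $F^0(c)=c$, $F^{t+1}(c,s^1,\dots,s^{t+1})=F(F^t(c,s^1,\dots,s^t),s^{t+1})$, and its non-deterministic global function is $N_F(c)=\{F(c,s):s\in R^{\mathbb Z}\}$. $\mathcal A$ is a plain probabilistic CA (PCA) if $V'=\{0\}$. For $m,t\ge 1$ and $k\in\mathbb Z$, the rescaling $\mathcal A^{\langle m,t,k\rangle}$ is the stochastic CA with state set $Q^m$, random symbols $(R^m)^t$ and explicit global function $(c,s)\mapsto b_m\circ\sigma_k\circ F^t(b_m^{-1}(c),b_m^{-1}(s^1),\dots,b_m^{-1}(s^t))$, where $\sigma_k(c)_z=c_{z+k}$, $b_m(c)_z=(c_{mz},\dots,c_{mz+m-1})$,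 and $s^1,\dots,s^t$ are the components of $s$. If $i:Q'\to Q$ is injective and $F$ maps $i(Q')^{\mathbb Z}\times R^{\mathbb Z}$ into $i(Q')^{\mathbb Z}$, the $i$-restriction of $\mathcal A$ is the stochastic CA with states $Q'$, random symbols $R$ and explicit global function $(c,s)\mapsto I^{-1}(F(I(c),s))$, where $I$ is the cell-by-cell extension of $i$. If $\pi:Q\to Q'$ is surjective, with cell-by-cell extension $\Pi$, and $\Pi(F(c,s))$ depends only on $\Pi(c)$ and $s$, the $\pi$-projection of $\mathcal A$ is the stochastic CA with states $Q'$, random symbols $R$ and explicit global function $(\Pi(c),s)\mapsto\Pi(F(c,s))$. Write $\mathcal A_1\sqsubseteq^N\mathcal A_2$ if some $i$-restriction of $\mathcal A_2$ has the same non-deterministic global function as $\mathcal A_1$, and $\mathcal A_1\trianglelefteq^N\mathcal A_2$ if some $\pi$-projection of some $i$-restriction of $\mathcal A_2$ does. The non-deterministic injective (resp. mixed) simulation pre-order $\preceq^N_i$ (resp. $\preceq^N_m$) is defined by: $\mathcal A_1\preceq\mathcal A_2$ if there are $m_1,m_2,t_1,t_2\ge1$ and $k_1,k_2\in\mathbb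 Z$ such that $\mathcal A_1^{\langle m_1,t_1,k_1\rangle}$ is in relation $\sqsubseteq^N$ (resp. $\trianglelefteq^N$) with $\mathcal A_2^{\langle m_2,t_2,k_2\rangle}$. A stochastic CA $\mathcal U$ is $\preceq$-universal if $\mathcal A\preceq\mathcal U$ for every stochastic CA $\mathcal A$. **Theorem.** There exists a stochastic CA $\mathcal U$, which is a PCA, that is both $\preceq^N_i$-universal and $\preceq^N_m$-universal. Moreover $\mathcal U$ simulates every stochastic CA $\mathcal A$ by blocks, with no rescaling of $\mathcal A$ and no translation: there are $m,t\ge1$ (depending on $\mathcal A$) such that $\mathcal A\sqsubseteq^N\mathcal U^{\langle m,t,0\rangle}$. -/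

import Mathlib

/-- A (one-dimensional) stochastic cellular automaton with set of states `Q` and set of random
symbols `R`: two finite neighbourhoods `V, V' ⊆ ℤ` and a local transition function
`f : Q^V × R^V' → Q`. (Finiteness and non-emptiness of `Q` and `R` are required wherever such
automata are quantified over.) -/
structure SCA (Q : Type*) (R : Type*) where
  V : Finset ℤ
  V' : Finset ℤ
  f : (V → Q) → (V' → R) → Q

namespace SCA

variable {Q R Q' : Type*}

/-- Plain probabilistic cellular automata: each cell uses its own random symbol only. -/
def IsPCA (A : SCA Q R) : Prop := A.V' = {0}

/-- The explicit global function `F : Q^ℤ × R^ℤ → Q^ℤ`. -/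
def F (A : SCA Q R) (c : ℤ → Q) (s : ℤ → R) : ℤ → Q :=
  fun z => A.f (fun v => c (z + v)) (fun v' => s (z + v'))

/-- The iterates `F^t(c, s¹, …, sᵗ)` of the explicit global function. -/
def iter (A : SCA Q R) : (t : ℕ) → (ℤ → Q) → (Fin t → ℤ → R) → (ℤ → Q)
  | 0, c, _ => c
  | t + 1, c, s => A.F (A.iter t c (fun j => s j.castSucc)) (s (Fin.last t))

/-- The non-deterministic global function `c ↦ {F(c,s) : s ∈ R^ℤ}`. -/
def N (A : SCA Q R) (c : ℤ → Q) : Set (ℤ → Q) := {d | ∃ s : ℤ → R, d = A.F c s}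

/-! ### Trimming operations -/

/-- `(i(Q'))^ℤ` is `F`-stable. -/
def Stable (A : SCA Q R) (i : Q' → Q) : Prop :=
  ∀ (c : ℤ → Q) (s : ℤ → R), (∀ z, c z ∈ Set.range i) → ∀ z, A.F c s z ∈ Set.range i

theorem Stable.local [Nonempty Q'] [Nonempty R] {A : SCA Q R} {i : Q' → Q} (h : A.Stable i)
    (q : A.V → Q') (r : A.V' → R) : ∃ a, i a = A.f (fun v => i (q v)) r := by
  classical
  have := h (fun z => i (if hz : z ∈ A.V then q ⟨z, hz⟩ else Classical.arbitrary Q'))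
    (fun z => if hz : z ∈ A.V' then r ⟨z, hz⟩ else Classical.arbitrary R) (fun z => ⟨_, rfl⟩) 0
  simpa [F] using this

/-- The `i`-restriction of `A`, for `i` injective with `(i(Q'))^ℤ` stable: the local function
`i⁻¹ ∘ f ∘ i`. -/
noncomputable def restrict [Nonempty Q'] [Nonempty R] (A : SCA Q R) (i : Q' → Q)
    (_hi : Function.Injective i) (hs : A.Stable i) : SCA Q' R where
  V := A.V
  V' := A.V'
  f := fun q r => Classical.choose (hs.local q r)

theorem restrict_F [Nonempty Q'] [Nonempty R] (A : SCA Q R) (i : Q' → Q)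
    (hi : Function.Injective i) (hs : A.Stable i) (c : ℤ → Q') (s : ℤ → R) :
    i ∘ (A.restrict i hi hs).F c s = A.F (i ∘ c) s :=
  funext fun z => Classical.choose_spec (hs.local (fun v => c (z + v)) (fun v' => s (z + v')))

/-- `π` is `F`-compatible. -/
def Compatible (A : SCA Q R) (π : Q → Q') : Prop :=
  ∀ (s : ℤ → R) (c c' : ℤ → Q), π ∘ c = π ∘ c' → π ∘ A.F c s = π ∘ A.F c' s

/-- The `π`-projection of `A`, for `π` surjective and compatible. -/
noncomputable def project (A : SCA Q R) (π : Q → Q')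
    (hπ : Function.Surjective π) (_hc : A.Compatible π) : SCA Q' R where
  V := A.V
  V' := A.V'
  f := fun q r => π (A.f (fun v => Function.surjInv hπ (q v)) r)

theorem project_F (A : SCA Q R) (π : Q → Q')
    (hπ : Function.Surjective π) (hc : A.Compatible π) (c : ℤ → Q) (s : ℤ → R) :
    (A.project π hπ hc).F (π ∘ c) s = π ∘ A.F c s :=
  hc s (fun z => Function.surjInv hπ (π (c z))) c
    (funext fun z => Function.surjInv_eq hπ (π (c z)))

/-! ### Rescaling -/

/-- The translation `σ_k`. -/
def shift (k : ℤ) (c : ℤ → Q) : ℤ → Q := fun z => c (z + k)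

/-- The packing map `b_m : S^ℤ → (S^m)^ℤ`. -/
def pack (m : ℕ+) (c : ℤ → Q) : ℤ → (Fin m → Q) := fun z j => c (m * z + j)

/-- The inverse of the packing map. -/
def unpack (m : ℕ+) (c : ℤ → (Fin m → Q)) : ℤ → Q := fun z =>
  c (z / m) ⟨(z % m).toNat, by
    have h : (0 : ℤ) < m := by exact_mod_cast m.pos
    have := Int.emod_lt_of_pos z h
    have := Int.emod_nonneg z h.ne'
    omega⟩

/-- The explicit global function of the rescaling of `A` with parameters `(m, t, k)`:
`b_m ∘ σ_k ∘ F^t (b_m⁻¹(c), b_m⁻¹(s¹), …, b_m⁻¹(sᵗ))`. -/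
def rescaleF (A : SCA Q R) (m t : ℕ+) (k : ℤ) (c : ℤ → (Fin m → Q))
    (s : ℤ → (Fin t → Fin m → R)) : ℤ → (Fin m → Q) :=
  pack m (shift k (A.iter t (unpack m c) (fun j => unpack m (fun z => s z j))))

/-- The radius `ρ` of the neighbourhoods. -/
def radius (A : SCA Q R) : ℕ := (A.V ∪ A.V').sup Int.natAbs

/-- Extension of a pattern on `[-n, n]` to a configuration (in an arbitrary way outside). -/
noncomputable def extend (n : ℕ) (q : Finset.Icc (-(n : ℤ)) n → Q) : ℤ → Q := fun z =>
  if h : z ∈ Finset.Icc (-(n : ℤ)) n then q ⟨z, h⟩ else q ⟨0, by simp⟩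

/-- The rescaling `A^{⟨m,t,k⟩}` of `A`, with state set `Q^m` and random symbols `(R^m)^t`: the
stochastic CA whose explicit global function is `rescaleF` (see `rescale_F`). -/
noncomputable def rescale (A : SCA Q R) (m t : ℕ+) (k : ℤ) : SCA (Fin m → Q) (Fin t → Fin m → R) where
  V := Finset.Icc (-((t * A.radius + k.natAbs : ℕ) : ℤ)) (t * A.radius + k.natAbs : ℕ)
  V' := Finset.Icc (-((t * A.radius + k.natAbs : ℕ) : ℤ)) (t * A.radius + k.natAbs : ℕ)
  f := fun q r => A.rescaleF m t k (extend _ q) (extend _ r) 0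

theorem iter_congr (A : SCA Q R) (t : ℕ) : ∀ (c c' : ℤ → Q) (s s' : Fin t → ℤ → R) (z z' : ℤ),
    (∀ y : ℤ, y.natAbs ≤ t * A.radius → c (z + y) = c' (z' + y)) →
    (∀ j, ∀ y : ℤ, y.natAbs ≤ t * A.radius → s j (z + y) = s' j (z' + y)) →
    A.iter t c s z = A.iter t c' s' z' := by
  induction t with
  | zero => intro c c' s s' z z' h _; simpa [iter] using h 0 (by simp)
  | succ t ih =>
    intro c c' s s' z z' h h'
    have hr : (t + 1) * A.radius = t * A.radius + A.radius := by ring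
    have hV : ∀ v ∈ A.V ∪ A.V', v.natAbs ≤ A.radius := fun v hv =>
      Finset.le_sup (f := Int.natAbs) hv
    simp only [iter, F]
    congr 1
    · funext v
      have hv := hV v (Finset.mem_union_left _ v.2)
      apply ih
      · intro y hy
        simpa [add_assoc] using h (v + y) (by omega)
      · intro j y hy
        simpa [add_assoc] using h' j.castSucc (v + y) (by omega)
    · funext v
      have hv := hV v (Finset.mem_union_right _ v.2)
      exact h' _ v (by omega)

theorem unpack_extend (m : ℕ+) (n : ℕ) (c : ℤ → (Fin m → Q)) (z : ℤ) (j : Fin m) (x : ℤ)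
    (hx : x.natAbs ≤ n) :
    unpack m c (m * z + j + x) =
      unpack m (extend n (fun v => c (z + v))) (m * 0 + j + x) := by
  have hm : (0 : ℤ) < m := by exact_mod_cast m.pos
  have hj : (j : ℤ) < m := by exact_mod_cast j.2
  have e : (m * z + j + x : ℤ) = (j + x) + m * z := by ring
  have hx1 : -(n : ℤ) ≤ x := by omega
  have hx2 : x ≤ n := by omega
  have hmem : ((j : ℤ) + x) / m ∈ Finset.Icc (-(n : ℤ)) n := by
    rw [Finset.mem_Icc]
    have hn : (n : ℤ) ≤ m * n := by nlinarith
    constructor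
    · rw [Int.le_ediv_iff_mul_le hm]; nlinarith
    · refine Int.lt_add_one_iff.mp ?_
      rw [Int.ediv_lt_iff_lt_mul hm]; nlinarith
  simp only [unpack, extend, mul_zero, zero_add]
  rw [dif_pos hmem]
  simp only [e, Int.add_mul_emod_self_left, Int.add_mul_ediv_left _ _ hm.ne']
  rw [add_comm z]

theorem rescale_F (A : SCA Q R) (m t : ℕ+) (k : ℤ) : (A.rescale m t k).F = A.rescaleF m t k := by
  funext c s z j
  simp only [F, rescale, rescaleF, pack, shift]
  symm
  apply iter_congr
  · intro y hy
    have := unpack_extend m (t * A.radius + k.natAbs) c z j (k + y) (by omega)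
    simpa only [add_assoc] using this
  · intro i y hy
    have := unpack_extend m (t * A.radius + k.natAbs) (fun z => s z i) z j (k + y) (by omega)
    simp only [add_assoc] at this ⊢
    rw [this]
    congr 1
    funext w
    simp only [extend]
    split <;> rfl

/-! ### Non-deterministic local relations and simulation pre-orders -/

section

variable {Q₁ R₁ Q₂ R₂ : Type*}

/-- `A₁` is a non-deterministic subautomaton of `A₂`. -/
def NSub [Nonempty Q₁] [Nonempty R₂] (A₁ : SCA Q₁ R₁) (A₂ : SCA Q₂ R₂) : Prop :=
  ∃ (i : Q₁ → Q₂) (hi : Function.Injective i) (hs : A₂.Stable i),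
    A₁.N = (A₂.restrict i hi hs).N

end

/-- `A₁` is, non-deterministically, a projection of a restriction of `A₂`. -/
def NMix.{u₁, v₁, u₂, v₂} {Q₁ : Type u₁} {R₁ : Type v₁} {Q₂ : Type u₂} {R₂ : Type v₂}
    [Nonempty R₂] (A₁ : SCA Q₁ R₁) (A₂ : SCA Q₂ R₂) : Prop :=
  ∃ (Q' : Type u₂) (_ : Finite Q') (_ : Nonempty Q') (i : Q' → Q₂) (hi : Function.Injective i)
    (hs : A₂.Stable i) (π : Q' → Q₁) (hπ : Function.Surjective π)
    (hc : (A₂.restrict i hi hs).Compatible π),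
    A₁.N = ((A₂.restrict i hi hs).project π hπ hc).N

section

variable {Q₁ R₁ Q₂ R₂ : Type*}

/-- The non-deterministic injective simulation pre-order. -/
def NSimInj [Nonempty Q₁] [Nonempty R₂] (A₁ : SCA Q₁ R₁) (A₂ : SCA Q₂ R₂) : Prop :=
  ∃ (m₁ m₂ t₁ t₂ : ℕ+) (k₁ k₂ : ℤ), NSub (A₁.rescale m₁ t₁ k₁) (A₂.rescale m₂ t₂ k₂)

/-- The non-deterministic mixed simulation pre-order. -/
def NSimMix [Nonempty R₂] (A₁ : SCA Q₁ R₁) (A₂ : SCA Q₂ R₂) : Prop :=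
  ∃ (m₁ m₂ t₁ t₂ : ℕ+) (k₁ k₂ : ℤ), NMix (A₁.rescale m₁ t₁ k₁) (A₂.rescale m₂ t₂ k₂)

end

end SCA

/-!
A simulation is an equality: the configurations reachable from an encoded configuration `e c` in a
fixed number of steps are exactly the encodings of the successors of `c`. Such equalities compose,
so a stochastic automaton may first be replaced by a plain probabilistic one of radius one: every
cell draws its random symbol, and then the symbols and states within the original radius are
collected in a window, one cell per step.

The configuration of the universal automaton consists of blocks, one for each simulated cell. A
block holds a word on a data loop, which turns in front of a fixed head, while an instruction track
passes the head, so that in one turn of the loop the head visits every position of the word once.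
In the first turn the head draws a random bit for every position and sends its word to both
neighbours, on message tracks of speed two; hence the words arrive at the neighbouring heads after
half of the period of the instruction track, and there a turn is spent on receiving them. The rest
of the period evaluates the local function by comparison with a table of all inputs. As the random
bits of different positions and blocks are independent coins, every random word is possible in
every block.
-/

namespace SCA

section Reachability

variable {Q R Q' R' Q'' R'' : Type*}

/-- The trajectory of `c` under noise indexed by all natural numbers; unlike in `iter`, the type of
the noise does not depend on the number of steps. -/
def orbit (A : SCA Q R) (c : ℤ → Q) (s : ℕ → ℤ → R) (t : ℕ) : ℤ → Q :=
  A.iter t c fun j => s j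

theorem orbit_succ (A : SCA Q R) (c : ℤ → Q) (s : ℕ → ℤ → R) (t : ℕ) :
    A.orbit c s (t + 1) = A.F (A.orbit c s t) (s t) := rfl

/-- The set of configurations reachable from `c` in exactly `t` steps. -/
def reach (A : SCA Q R) (t : ℕ) (c : ℤ → Q) : Set (ℤ → Q) := Set.range (A.iter t c)

theorem reach_eq_range_orbit [Nonempty R] (A : SCA Q R) (t : ℕ) (c : ℤ → Q) :
    A.reach t c = Set.range fun s => A.orbit c s t := by
  refine Set.Subset.antisymm ?_ (Set.range_subset_iff.2 fun s => ⟨_, rfl⟩)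
  rintro _ ⟨s, rfl⟩
  refine ⟨fun j => if hj : j < t then s ⟨j, hj⟩ else Classical.arbitrary _, ?_⟩
  simp only [orbit, Fin.is_lt, dif_pos]

theorem reach_zero (A : SCA Q R) (c : ℤ → Q) : A.reach 0 c = {c} := Set.range_const

theorem mem_reach_succ {A : SCA Q R} {t : ℕ} {c d : ℤ → Q} :
    d ∈ A.reach (t + 1) c ↔ ∃ d' ∈ A.reach t c, d ∈ A.N d' := by
  constructor
  · rintro ⟨s, rfl⟩
    exact ⟨_, ⟨_, rfl⟩, _, rfl⟩
  · rintro ⟨_, ⟨s, rfl⟩, s', rfl⟩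
    exact ⟨Fin.snoc (α := fun _ => ℤ → R) s s', by simp [iter]⟩

theorem mem_reach_add {A : SCA Q R} {t u : ℕ} {c d : ℤ → Q} :
    d ∈ A.reach (t + u) c ↔ ∃ d' ∈ A.reach t c, d ∈ A.reach u d' := by
  induction u generalizing d with
  | zero => simp [reach_zero]
  | succ u ih =>
    simp only [← add_assoc, mem_reach_succ, ih]
    tauto

/-- `t` steps of `B` from the encoding `e c` of a configuration `c` of `A` lead exactly to the
encodings of the successors of `c`. -/
def Simulates (B : SCA Q' R') (t : ℕ) (e : (ℤ → Q) → (ℤ → Q')) (A : SCA Q R) : Prop :=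
  ∀ c, B.reach t (e c) = e '' A.N c

theorem Simulates.of_orbit [Nonempty R'] {B : SCA Q' R'} {t : ℕ} {e : (ℤ → Q) → (ℤ → Q')}
    {A : SCA Q R} (φ : (ℕ → ℤ → R') → ℤ → R) (hφ : Function.Surjective φ)
    (h : ∀ c s, B.orbit (e c) s t = e (A.F c (φ s))) : B.Simulates t e A := by
  intro c
  rw [reach_eq_range_orbit]
  ext d
  constructor
  · rintro ⟨s, rfl⟩
    exact ⟨_, ⟨φ s, rfl⟩, (h c s).symm⟩
  · rintro ⟨_, ⟨r, rfl⟩, rfl⟩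
    obtain ⟨s, rfl⟩ := hφ r
    exact ⟨s, h c s⟩

theorem Simulates.reach_mul {B : SCA Q' R'} {t : ℕ} {e : (ℤ → Q) → (ℤ → Q')} {A : SCA Q R}
    (h : B.Simulates t e A) (k : ℕ) (c : ℤ → Q) : B.reach (t * k) (e c) = e '' A.reach k c := by
  induction k with
  | zero => simp [reach_zero]
  | succ k ih =>
    ext d
    rw [Nat.mul_succ, mem_reach_add, ih]
    constructor
    · rintro ⟨_, ⟨d', hd', rfl⟩, hd⟩
      rw [h d'] at hd
      obtain ⟨d, hd, rfl⟩ := hd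
      exact ⟨d, mem_reach_succ.2 ⟨d', hd', hd⟩, rfl⟩
    · rintro ⟨d, hd, rfl⟩
      obtain ⟨d', hd', hd⟩ := mem_reach_succ.1 hd
      exact ⟨e d', ⟨d', hd', rfl⟩, (h d').symm ▸ ⟨d, hd, rfl⟩⟩

theorem Simulates.trans {C : SCA Q'' R''} {B : SCA Q' R'} {A : SCA Q R} {t u : ℕ}
    {e : (ℤ → Q) → (ℤ → Q')} {e' : (ℤ → Q') → (ℤ → Q'')} (hC : C.Simulates u e' B)
    (hB : B.Simulates t e A) : C.Simulates (u * t) (e' ∘ e) A := by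
  intro c
  rw [Function.comp_apply, hC.reach_mul, hB c, Set.image_comp]

end Reachability

section Subautomata

variable {Q R Q' Q₁ R₁ Q₂ R₂ : Type*}

theorem image_restrict_N [Nonempty Q'] [Nonempty R] (A : SCA Q R) (i : Q' → Q)
    (hi : Function.Injective i) (hs : A.Stable i) (c : ℤ → Q') :
    (i ∘ ·) '' (A.restrict i hi hs).N c = A.N (i ∘ c) := by
  ext d
  simp [N, restrict_F, eq_comm]

theorem project_N_comp (A : SCA Q R) (π : Q → Q') (hπ : Function.Surjective π)
    (hc : A.Compatible π) (c : ℤ → Q) : (A.project π hπ hc).N (π ∘ c) = (π ∘ ·) '' A.N c := by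
  ext d
  simp [N, project_F, eq_comm]

theorem Compatible.of_injective (A : SCA Q R) {π : Q → Q'} (hπ : Function.Injective π) :
    A.Compatible π := fun _ _ _ h => by rw [hπ.comp_left h]

theorem nSub_iff [Nonempty Q₁] [Nonempty R₂] {A₁ : SCA Q₁ R₁} {A₂ : SCA Q₂ R₂} :
    NSub A₁ A₂ ↔
      ∃ i : Q₁ → Q₂, Function.Injective i ∧ ∀ c, A₂.N (i ∘ c) = (i ∘ ·) '' A₁.N c := by
  constructor
  · rintro ⟨i, hi, hs, hN⟩
    exact ⟨i, hi, fun c => by rw [hN, image_restrict_N]⟩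
  · rintro ⟨i, hi, hN⟩
    have hs : A₂.Stable i := by
      intro c s hc
      choose c' hc' using hc
      obtain rfl : i ∘ c' = c := funext hc'
      obtain ⟨d, -, hd⟩ : A₂.F (i ∘ c') s ∈ (i ∘ ·) '' A₁.N c' := hN c' ▸ ⟨s, rfl⟩
      exact fun z => ⟨d z, congrFun hd z⟩
    refine ⟨i, hi, hs, funext fun c => hi.comp_left.image_injective ?_⟩
    rw [image_restrict_N, hN]

theorem NSub.nMix [Finite Q₁] [Nonempty Q₁] [Nonempty R₂] {A₁ : SCA Q₁ R₁} {A₂ : SCA Q₂ R₂}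
    (h : NSub A₁ A₂) : NMix A₁ A₂ := by
  obtain ⟨i, hi, hs, hN⟩ := h
  let e : Q₁ ≃ Set.range i := Equiv.ofInjective i hi
  have he (c : ℤ → Q₁) : Subtype.val ∘ e ∘ c = i ∘ c := rfl
  have hs' : A₂.Stable (Subtype.val : Set.range i → Q₂) := by
    simpa only [Stable, Subtype.range_coe] using hs
  refine ⟨Set.range i, inferInstance, inferInstance, Subtype.val, Subtype.val_injective, hs',
    e.symm, e.symm.surjective, .of_injective _ e.symm.injective, funext fun c => ?_⟩
  obtain ⟨c, rfl⟩ : ∃ c', c = e.symm ∘ c' := ⟨e ∘ c, by ext z; simp⟩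
  rw [project_N_comp]
  apply hi.comp_left.image_injective
  rw [hN, image_restrict_N, Set.image_image]
  simp only [← he, ← Function.comp_assoc, e.self_comp_symm, Function.id_comp]
  exact (image_restrict_N ..).symm

end Subautomata

section Rescaling

variable {Q R Q' R' : Type*}

theorem shift_zero (c : ℤ → Q) : shift 0 c = c := by
  funext z
  simp [shift]

theorem pack_unpack (m : ℕ+) (c : ℤ → Fin m → Q) : pack m (unpack m c) = c := by
  funext z j
  have hm : (0 : ℤ) < m := by exact_mod_cast m.pos
  have hj : (j : ℤ) < m := by exact_mod_cast j.2
  obtain ⟨hdiv, hmod⟩ : ((m : ℤ) * z + j) / m = z ∧ ((m : ℤ) * z + j) % m = j :=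
    (Int.ediv_emod_unique hm).2 ⟨add_comm _ _, by omega, hj⟩
  simp [pack, unpack, hdiv, hmod]

theorem unpack_pack (m : ℕ+) (c : ℤ → Q) : unpack m (pack m c) = c := by
  funext z
  have hz : 0 ≤ z % m := Int.emod_nonneg z (by exact_mod_cast m.ne_zero)
  simp [pack, unpack, Int.toNat_of_nonneg hz, Int.mul_ediv_add_emod]

theorem rescale_N (A : SCA Q R) (m t : ℕ+) (k : ℤ) (c : ℤ → Fin m → Q) :
    (A.rescale m t k).N c = (fun d => pack m (shift k d)) '' A.reach t (unpack m c) := by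
  ext d
  simp only [N, rescale_F, rescaleF, Set.mem_ofPred_eq, reach, Set.exists_range_iff, Set.mem_image]
  constructor
  · rintro ⟨s, rfl⟩
    exact ⟨_, rfl⟩
  · rintro ⟨s, rfl⟩
    exact ⟨fun z j => pack m (s j) z, by simp only [unpack_pack]⟩

theorem Simulates.nSub_rescale [Nonempty Q] [Nonempty R'] {B : SCA Q' R'} {A : SCA Q R} {m t : ℕ+}
    {i : Q → Fin m → Q'} (hi : Function.Injective i)
    (h : B.Simulates t (fun c => unpack m (i ∘ c)) A) : NSub A (B.rescale m t 0) := by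
  refine nSub_iff.2 ⟨i, hi, fun c => ?_⟩
  rw [rescale_N, h c, Set.image_image]
  simp only [shift_zero, pack_unpack]

end Rescaling

section Nearest

variable {T R : Type*}

/-- The plain probabilistic automaton of radius one whose local rule `g` takes the states of the
left neighbour, of the cell and of the right neighbour, and the random symbol of the cell. -/
def nearest (g : T → T → T → R → T) : SCA T R where
  V := {-1, 0, 1}
  V' := {0}
  f := fun q r => g (q ⟨-1, by simp⟩) (q ⟨0, by simp⟩) (q ⟨1, by simp⟩) (r ⟨0, by simp⟩)

theorem nearest_F (g : T → T → T → R → T) (c : ℤ → T) (s : ℤ → R) (z : ℤ) :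
    (nearest g).F c s z = g (c (z - 1)) (c z) (c (z + 1)) (s z) := by
  simp [F, nearest, sub_eq_add_neg]

end Nearest

section Gather

variable {Q R : Type*}

theorem extend_apply_of_natAbs_le {n : ℕ} (q : Finset.Icc (-(n : ℤ)) n → Q) {i : ℤ}
    (hi : i.natAbs ≤ n) : extend n q i = q ⟨i, Finset.mem_Icc.2 (by omega)⟩ := dif_pos _

/-- States of the automaton `gather`, which collects the surroundings of each cell before it
applies a local rule of radius `n`: a phase, and a partially filled window of states and random
symbols. -/
abbrev Window (Q R : Type*) (n : ℕ) : Type _ := Fin (n + 2) × (Finset.Icc (-(n : ℤ)) n → Q × R)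

/-- The collecting phase of `gather`: every entry but the central one is taken from the window of
the neighbour one cell closer to it. -/
noncomputable def Window.collect {n : ℕ} (l x r : Window Q R n) : Window Q R n :=
  (x.1 + 1, fun i =>
    if (i : ℤ) = 0 then x.2 i else if 0 < (i : ℤ) then extend n r.2 (i - 1)
    else extend n l.2 (i + 1))

/-- All windows hold the entries of `u` at distance at most `j` from their cell, and the phase is
the one reached in `j` collecting steps. -/
def Collected (n : ℕ) (u : ℤ → Q × R) (j : ℕ) (d : ℤ → Window Q R n) : Prop :=
  ∀ z, ((d z).1 : ℕ) = j + 1 ∧ ∀ i : ℤ, i.natAbs ≤ j → extend n (d z).2 i = u (z + i)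

variable [Nonempty R]

/-- The encoding of a state of `A` as a state of `A.gather`; the random symbol stored in the window
is a dummy. -/
noncomputable def gatherInit (n : ℕ) (q : Q) : Window Q R n :=
  (0, fun _ => (q, Classical.arbitrary R))

theorem gatherInit_injective (n : ℕ) :
    Function.Injective (gatherInit n : Q → Window Q R n) := fun _ _ h =>
  congrArg Prod.fst (congrFun (congrArg Prod.snd h) ⟨0, by simp⟩)

/-- The local rule of `gather`: draw a random symbol, collect for `A.radius` steps, apply `A.f`. -/
noncomputable def gatherStep (A : SCA Q R) (l x r : Window Q R A.radius) (b : R) :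
    Window Q R A.radius :=
  if x.1 = 0 then (1, fun i => ((x.2 i).1, b))
  else if x.1 = Fin.last _ then
    gatherInit _ (A.f (fun v => (extend _ x.2 v).1) fun v => (extend _ x.2 v).2)
  else .collect l x r

/-- A plain probabilistic automaton of radius one that simulates `A` in `A.radius + 2` steps. -/
noncomputable def gather (A : SCA Q R) : SCA (Window Q R A.radius) R := nearest A.gatherStep

theorem collected_gather_F_init (A : SCA Q R) (c : ℤ → Q) (s : ℤ → R) :
    Collected A.radius (fun z => (c z, s z)) 0 (A.gather.F (gatherInit _ ∘ c) s) := by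
  intro z
  rw [gather, nearest_F]
  simp [gatherStep, gatherInit, extend]

theorem Collected.gather_F {A : SCA Q R} {u : ℤ → Q × R} {j : ℕ} {d : ℤ → Window Q R A.radius}
    (h : Collected A.radius u j d) (hj : j < A.radius) (s : ℤ → R) :
    Collected A.radius u (j + 1) (A.gather.F d s) := by
  intro z
  have hfirst : (d z).1 ≠ 0 := fun e => by simpa [e] using (h z).1
  have hlast : (d z).1 ≠ Fin.last _ := fun e => by
    have := (h z).1
    rw [e, Fin.val_last] at this
    omega
  rw [gather, nearest_F, gatherStep, if_neg hfirst, if_neg hlast, Window.collect]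
  refine ⟨by rw [Fin.val_add_one, if_neg hlast, (h z).1], fun i hi => ?_⟩
  rw [extend_apply_of_natAbs_le _ (by omega)]
  simp only
  split_ifs with hzero hpos
  · rw [← (h z).2 i (by omega), extend_apply_of_natAbs_le _ (by omega)]
  · rw [(h (z + 1)).2 (i - 1) (by omega)]
    congr 1
    omega
  · rw [(h (z - 1)).2 (i + 1) (by omega)]
    congr 1
    omega

theorem Collected.gather_F_last {A : SCA Q R} {u : ℤ → Q × R} {d : ℤ → Window Q R A.radius}
    (h : Collected A.radius u A.radius d) (s : ℤ → R) :
    A.gather.F d s = gatherInit _ ∘ A.F (fun z => (u z).1) fun z => (u z).2 := by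
  funext z
  have hfirst : (d z).1 ≠ 0 := fun e => by simpa [e] using (h z).1
  have hlast : (d z).1 = Fin.last _ := Fin.ext (h z).1
  have hu : ∀ v ∈ A.V ∪ A.V', extend _ (d z).2 v = u (z + v) := fun v hv =>
    (h z).2 v (Finset.le_sup (f := Int.natAbs) hv)
  rw [gather, nearest_F, gatherStep, if_neg hfirst, if_pos hlast, Function.comp_apply, F]
  congr 2
  · funext v
    rw [hu v (Finset.mem_union_left _ v.2)]
  · funext v
    rw [hu v (Finset.mem_union_right _ v.2)]

theorem orbit_gather (A : SCA Q R) (c : ℤ → Q) (s : ℕ → ℤ → R) :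
    A.gather.orbit (gatherInit _ ∘ c) s (A.radius + 2) = gatherInit _ ∘ A.F c (s 0) := by
  have hcollect : ∀ j ≤ A.radius, Collected A.radius (fun z => (c z, s 0 z)) j
      (A.gather.orbit (gatherInit _ ∘ c) s (j + 1)) := by
    intro j hj
    induction j with
    | zero => exact collected_gather_F_init A c (s 0)
    | succ j ih => exact (ih (by omega)).gather_F hj _
  exact (hcollect _ le_rfl).gather_F_last _

theorem simulates_gather (A : SCA Q R) :
    A.gather.Simulates (A.radius + 2) (gatherInit _ ∘ ·) A :=
  .of_orbit (fun s => s 0) (fun r => ⟨fun _ => r, rfl⟩) (orbit_gather A)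

end Gather

/-- The bits from which a block computes its next word, at one position of the data loop: the bit of
its own word, a random bit, and the bits of the words of the left and right neighbours. -/
structure Input where
  own : Bool
  random : Bool
  left : Bool
  right : Bool
  deriving DecidableEq, Fintype

/-- The content of a cell of the data loop: the bits already gathered and an output bit. -/
structure Datum extends Input where
  out : Bool
  deriving Fintype

/-- What a head receives in one step: the messages from the left and from the right, and a random
bit. -/
structure Signal where
  left : Bool
  right : Bool
  random : Bool
  deriving Fintype

/-- An instruction acts on the accumulator and on the datum in front of the head; its last component
is the message, which the head sends both to the left and to the right. -/
abbrev Instr : Type := Bool → Datum → Signal → Bool × Datum × Bool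

section Loop

variable {n : ℕ}

/-- The state of a head: its accumulator and the content of its data loop. -/
abbrev Loop (n : ℕ) : Type := Bool × (ZMod n → Datum)

/-- The state after the execution of an instruction at the position `k` of the data loop. -/
def Loop.step (σ : Loop n) (I : Instr) (k : ZMod n) (i : Signal) : Loop n :=
  ((I σ.1 (σ.2 k) i).1, Function.update σ.2 k (I σ.1 (σ.2 k) i).2.1)

/-- The message sent when an instruction is executed at the position `k` of the data loop. -/
def Loop.message (σ : Loop n) (I : Instr) (k : ZMod n) (i : Signal) : Bool := (I σ.1 (σ.2 k) i).2.2

/-- The state reached from `σ` after a number of steps of the program `P`. The data loop turns by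
one position in each step. -/
def run (P : ℕ → Instr) (inp : ℕ → Signal) (σ : Loop n) : ℕ → Loop n
  | 0 => σ
  | τ + 1 => (run P inp σ τ).step (P τ) τ (inp τ)

theorem run_add (P : ℕ → Instr) (inp : ℕ → Signal) (σ : Loop n) {m : ℕ} (hm : n ∣ m) (j : ℕ) :
    run P inp σ (m + j) = run (fun τ => P (m + τ)) (fun τ => inp (m + τ)) (run P inp σ m) j := by
  induction j with
  | zero => rfl
  | succ j ih =>
    rw [← add_assoc, run, ih, run, Nat.cast_add, (ZMod.natCast_eq_zero_iff m n).2 hm, zero_add]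

theorem run_congr {P P' : ℕ → Instr} {inp inp' : ℕ → Signal} (σ : Loop n) {m : ℕ}
    (hP : ∀ τ < m, P τ = P' τ) (hinp : ∀ τ < m, inp τ = inp' τ) :
    run P inp σ m = run P' inp' σ m := by
  induction m with
  | zero => rfl
  | succ m ih =>
    rw [run, run, hP m m.lt_succ_self, hinp m m.lt_succ_self, ih (fun τ hτ => hP τ (by omega))
      fun τ hτ => hinp τ (by omega)]

theorem run_eq_of_forall_lt [NeZero n] {P : ℕ → Instr} {inp : ℕ → Signal} (a : ℕ → Bool)
    (old new : ZMod n → Datum)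
    (h : ∀ j < n, (P j (a j) (old j) (inp j)).1 = a (j + 1) ∧
      (P j (a j) (old j) (inp j)).2.1 = new j) {j : ℕ} (hj : j ≤ n) :
    run P inp (a 0, old) j = (a j, fun k => if k.val < j then new k else old k) := by
  induction j with
  | zero => simp [run]
  | succ j ih =>
    have hval : (j : ZMod n).val = j := ZMod.val_cast_of_lt hj
    obtain ⟨hacc, hdatum⟩ := h j hj
    simp only [run, ih (by omega), Loop.step, hval, lt_irrefl, if_false, hacc, hdatum]
    congr 1
    funext k
    obtain rfl | hk := eq_or_ne k j
    · simp [hval]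
    · have : k.val ≠ j := fun e => hk (by rw [← e, ZMod.natCast_zmod_val])
      rw [Function.update_of_ne hk]
      exact if_congr (by omega) rfl rfl

end Loop

section Program

variable {n : ℕ}

/-- A bit at every position of the data loop. -/
abbrev Word (n : ℕ) : Type := ZMod n → Bool

/-- The operations out of which programs are made; each of them is carried out in one turn of the
data loop. The accumulator records whether a comparison has failed. -/
inductive Op (n : ℕ) : Type
  | draw
  | clear
  | receive
  | compare (v : ZMod n → Input)
  | write (v : Word n)
  | store

/-- The instruction that an operation executes at the position `k` of the data loop. -/
def Op.instr : Op n → ZMod n → Instr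
  | draw, _ => fun a d i => (a, { d with random := i.random }, d.own)
  | clear, _ => fun _ d _ => (false, d, false)
  | receive, _ => fun a d i => (a, { d with left := i.left, right := i.right }, false)
  | compare v, k => fun a d _ => (a || decide (d.toInput ≠ v k), d, false)
  | write v, k => fun a d _ => (a, { d with out := if a then d.out else v k }, false)
  | store, _ => fun a d _ => (a, ⟨⟨d.out, false, false, false⟩, false⟩, false)

theorem Op.message_instr {op : Op n} (hop : op ≠ .draw) (k : ZMod n) (a : Bool) (d : Datum)
    (i : Signal) : (op.instr k a d i).2.2 = false := by
  cases op <;> first | rfl | exact absurd rfl hop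

/-- The accumulator after an operation has visited the positions less than `j`. -/
def Op.acc (σ : Loop n) : Op n → ℕ → Bool
  | clear, j => if j = 0 then σ.1 else false
  | compare v, j => σ.1 || decide (∃ k < j, (σ.2 k).toInput ≠ v k)
  | _, _ => σ.1

/-- The effect of an operation on the state of a head, if `inp` is received during the turn. -/
def Op.effect (inp : ℕ → Signal) (op : Op n) (σ : Loop n) : Loop n :=
  (op.acc σ n, fun k => (op.instr k σ.1 (σ.2 k) (inp k.val)).2.1)

theorem run_instr [NeZero n] (op : Op n) (inp : ℕ → Signal) (σ : Loop n) {j : ℕ} (hj : j ≤ n) :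
    run (fun τ => op.instr τ) inp σ j =
      (op.acc σ j, fun k => if k.val < j then (op.effect inp σ).2 k else σ.2 k) := by
  have hzero : (op.acc σ 0, σ.2) = σ := by cases op <;> simp [Op.acc]
  have hstep : ∀ j < n, (op.instr j (op.acc σ j) (σ.2 j) (inp j)).1 = op.acc σ (j + 1) ∧
      (op.instr j (op.acc σ j) (σ.2 j) (inp j)).2.1 = (op.effect inp σ).2 j := by
    intro j hj
    have hval : (j : ZMod n).val = j := ZMod.val_cast_of_lt hj
    cases op with
    | compare v =>
      simp only [Op.instr, Op.acc, Op.effect, Nat.lt_succ_iff_lt_or_eq, or_and_right, exists_or,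
        exists_eq_left, Bool.decide_or, Bool.or_assoc, and_self]
    | write v => exact ⟨rfl, rfl⟩
    | _ => simp [Op.instr, Op.acc, Op.effect, hval]
  simpa only [hzero] using
    run_eq_of_forall_lt (P := fun τ => op.instr τ) (op.acc σ) σ.2 (op.effect inp σ).2 hstep hj

theorem run_instr_turn [NeZero n] (op : Op n) (inp : ℕ → Signal) (σ : Loop n) :
    run (fun τ => op.instr τ) inp σ n = op.effect inp σ := by
  simp only [run_instr op inp σ le_rfl, ZMod.val_lt, if_true, Op.effect]

/-- The program that carries out the given operations one after the other. -/
def program (ops : List (Op n)) (τ : ℕ) : Instr := (ops.getD (τ / n) .clear).instr τ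

theorem program_message {ops : List (Op n)} (hops : .draw ∉ ops) (τ : ℕ) (a : Bool) (d : Datum)
    (i : Signal) : (program ops τ a d i).2.2 = false := by
  refine Op.message_instr (fun hdraw => ?_) ..
  obtain hτ | hτ := lt_or_ge (τ / n) ops.length
  · rw [List.getD_eq_getElem _ _ hτ] at hdraw
    exact hops (hdraw ▸ List.getElem_mem hτ)
  · rw [List.getD_eq_default _ _ hτ] at hdraw
    cases hdraw

/-- The effect of a list of operations on the state of a head. -/
def exec (inp : ℕ → Signal) : List (Op n) → Loop n → Loop n
  | [], σ => σ
  | op :: ops, σ => exec (fun τ => inp (n + τ)) ops (op.effect inp σ)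

theorem exec_append (inp : ℕ → Signal) (l l' : List (Op n)) (σ : Loop n) :
    exec inp (l ++ l') σ = exec (fun τ => inp (n * l.length + τ)) l' (exec inp l σ) := by
  induction l generalizing inp σ with
  | nil => simp [exec]
  | cons op l ih =>
    rw [List.cons_append, exec, ih, exec]
    congr 1
    funext τ
    congr 1
    rw [List.length_cons]
    ring

theorem program_cons_of_lt (op : Op n) (ops : List (Op n)) {τ : ℕ} (hτ : τ < n) :
    program (op :: ops) τ = op.instr τ := by
  rw [program, Nat.div_eq_of_lt hτ, List.getD_cons_zero]

theorem program_cons_add [NeZero n] (op : Op n) (ops : List (Op n)) (τ : ℕ) :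
    program (op :: ops) (n + τ) = program ops τ := by
  rw [program, Nat.add_div_left _ (NeZero.pos n), List.getD_cons_succ, program, Nat.cast_add,
    ZMod.natCast_self, zero_add]

theorem run_program [NeZero n] (ops : List (Op n)) (inp : ℕ → Signal) (σ : Loop n) :
    run (program ops) inp σ (n * ops.length) = exec inp ops σ := by
  induction ops generalizing inp σ with
  | nil => rfl
  | cons op ops ih =>
    rw [List.length_cons, mul_add_one, add_comm, run_add _ _ _ dvd_rfl,
      run_congr σ (fun τ hτ => program_cons_of_lt op ops hτ) fun _ _ => rfl, run_instr_turn]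
    simp only [program_cons_add, ih, exec]

section Transducer

theorem exec_replicate_clear (inp : ℕ → Signal) (m : ℕ) (D : ZMod n → Datum) :
    exec inp (.replicate m .clear) (false, D) = (false, D) := by
  induction m generalizing inp with
  | zero => rfl
  | succ m ih =>
    have hclear : Op.effect inp .clear (false, D) = (false, D) := by
      simp [Op.effect, Op.acc, Op.instr]
    rw [List.replicate_succ, exec, hclear, ih]

/-- Evaluation of the function `f` on the inputs in the list `rows`, by comparison with each of
them. -/
def lookup (f : (ZMod n → Input) → Word n) (rows : List (ZMod n → Input)) : List (Op n) :=
  rows.flatMap fun v => [.compare v, .write (f v), .clear]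

/-- The content of the data loop of a block which represents the word `x`. -/
def load (x : Word n) : ZMod n → Datum := fun k => ⟨⟨x k, false, false, false⟩, false⟩

/-- The input on which a block with the word `x` evaluates its function. -/
def gathered (ℓ : ℕ) (inp : ℕ → Signal) (x : Word n) (k : ZMod n) : Input :=
  ⟨x k, (inp k.val).random, (inp (n * ℓ + k.val)).left, (inp (n * ℓ + k.val)).right⟩

/-- The messages sent by a block with the word `x`. -/
def sent (x : Word n) (τ : ℕ) : Bool := if τ < n then x τ else false

theorem draw_notMem_lookup (f : (ZMod n → Input) → Word n) (rows : List (ZMod n → Input)) :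
    .draw ∉ lookup f rows := by
  simp [lookup]

variable [NeZero n]

theorem exec_compare_write_clear (inp : ℕ → Signal) (v u : ZMod n → Input) (y out : Word n) :
    exec inp [.compare v, .write y, .clear] (false, fun k => ⟨u k, out k⟩) =
      (false, fun k => ⟨u k, if u = v then y k else out k⟩) := by
  have hne : (∃ k < n, u (k : ZMod n) ≠ v k) ↔ u ≠ v := by
    rw [Function.ne_iff]
    exact ⟨fun ⟨k, _, hk⟩ => ⟨k, hk⟩, fun ⟨k, hk⟩ =>
      ⟨k.val, ZMod.val_lt k, by rwa [ZMod.natCast_zmod_val]⟩⟩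
  by_cases h : u = v <;> simp [exec, Op.effect, Op.acc, Op.instr, hne, h, NeZero.ne n]

theorem exec_lookup (inp : ℕ → Signal) (f : (ZMod n → Input) → Word n)
    {rows : List (ZMod n → Input)} {u : ZMod n → Input} {out : Word n}
    (h : u ∈ rows ∨ out = f u) :
    exec inp (lookup f rows) (false, fun k => ⟨u k, out k⟩) = (false, fun k => ⟨u k, f u k⟩) := by
  induction rows generalizing inp out with
  | nil => rw [h.resolve_left List.not_mem_nil]; rfl
  | cons v rows ih =>
    rw [lookup, List.flatMap_cons, exec_append, exec_compare_write_clear]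
    apply ih
    rw [List.mem_cons] at h
    obtain rfl | hv := eq_or_ne u v
    · simp
    · simpa [hv] using h

/-- The second half of the program of a block: computing and storing the output. -/
noncomputable def evaluation (f : (ZMod n → Input) → Word n) : List (Op n) :=
  lookup f Finset.univ.toList ++ [.store]

/-- The program of a block. The operations `clear` are a delay, which makes the messages sent
while drawing arrive exactly in the turn in which they are received. -/
noncomputable def transducer (f : (ZMod n → Input) → Word n) : List (Op n) :=
  .draw :: (.replicate (evaluation f).length .clear ++ .receive :: evaluation f)

theorem exec_evaluation (inp : ℕ → Signal) (f : (ZMod n → Input) → Word n) (u : ZMod n → Input) :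
    exec inp (evaluation f) (false, fun k => ⟨u k, false⟩) = (false, load (f u)) := by
  rw [evaluation, exec_append, exec_lookup inp f (.inl (Finset.mem_toList.2 (Finset.mem_univ u)))]
  rfl

theorem exec_transducer (inp : ℕ → Signal) (f : (ZMod n → Input) → Word n) (x : Word n) :
    exec inp (transducer f) (false, load x) =
      (false, load (f (gathered ((evaluation f).length + 1) inp x))) := by
  have hdraw : Op.effect inp .draw (false, load x) =
      (false, fun k => ⟨⟨x k, (inp k.val).random, false, false⟩, false⟩) := rfl
  have hreceive (inp' : ℕ → Signal) (r : Word n) :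
      Op.effect inp' .receive (false, fun k => ⟨⟨x k, r k, false, false⟩, false⟩) =
      (false, fun k => ⟨⟨x k, r k, (inp' k.val).left, (inp' k.val).right⟩, false⟩) := rfl
  have hshift (j : ℕ) :
      n + (n * (evaluation f).length + j) = n * ((evaluation f).length + 1) + j := by ring
  rw [transducer, exec, hdraw, exec_append, exec_replicate_clear, List.length_replicate, exec,
    hreceive, exec_evaluation]
  simp only [hshift]
  rfl

theorem message_transducer (inp : ℕ → Signal) (f : (ZMod n → Input) → Word n) (x : Word n)
    (τ : ℕ) :
    (run (program (transducer f)) inp (false, load x) τ).message (program (transducer f) τ) τ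
      (inp τ) = sent x τ := by
  by_cases hτ : τ < n
  · have hval : (τ : ZMod n).val = τ := ZMod.val_cast_of_lt hτ
    rw [transducer, run_congr _ (fun t ht => program_cons_of_lt _ _ (ht.trans hτ)) fun _ _ => rfl,
      run_instr _ _ _ hτ.le, program_cons_of_lt _ _ hτ, sent, if_pos hτ]
    simp [Loop.message, Op.instr, hval, load]
  · obtain ⟨t, rfl⟩ := Nat.exists_eq_add_of_le (not_lt.1 hτ)
    rw [sent, if_neg hτ, transducer, program_cons_add, Loop.message]
    exact program_message (by simp [evaluation, draw_notMem_lookup]) ..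

end Transducer

end Program

section Universal

instance : Finite Instr :=
  have : Finite (Datum → Signal → Bool × Datum × Bool) := Pi.finite
  Pi.finite

/-- States of the universal automaton. The cells marked by `zone`, with the head at their left end
and the wall at their right end, carry two lanes that form a data loop. -/
@[ext]
structure UState where
  /-- instruction track, moving to the left at speed one -/
  prog : Instr
  head : Bool
  zone : Bool
  wall : Bool
  acc : Bool
  /-- lane of the data loop moving to the right at speed one -/
  up : Datum
  /-- lane of the data loop moving to the left at speed one -/
  down : Datum
  /-- message track moving to the left at speed two -/
  msgL : Bool
  /-- message track moving to the right at speed two -/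
  msgR : Bool

/-- The content of the lanes outside of the data loops. -/
def blank : Datum := ⟨⟨false, false, false, false⟩, false⟩

instance : Finite UState :=
  Finite.of_injective
    (fun x => (x.prog, x.head, x.zone, x.wall, x.acc, x.up, x.down, x.msgL, x.msgR))
    fun x y h => by
      simp only [Prod.mk.injEq] at h
      ext1 <;> tauto

instance : Nonempty UState :=
  ⟨⟨fun a d _ => (a, d, false), false, false, false, false, blank, blank, false, false⟩⟩

/-- The local rule of the universal automaton: `x` is the state of the cell, `b` its random bit, and
`l₂`, `l₁`, `r₁`, `r₂` are the states of the neighbours, from left to right. All tracks move, and a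
head executes the instruction in its cell. -/
def UState.next (l₂ l₁ x r₁ r₂ : UState) (b : Bool) : UState :=
  let y := x.prog x.acc x.down ⟨l₂.msgR, r₂.msgL, b⟩
  { prog := r₁.prog
    head := x.head
    zone := x.zone
    wall := x.wall
    acc := if x.head then y.1 else x.acc
    up := if x.head then y.2.1 else if x.zone then l₁.up else blank
    down := if x.wall then x.up else if x.zone then r₁.down else blank
    msgL := if x.head then y.2.2 else r₂.msgL
    msgR := if x.head then y.2.2 else l₂.msgR }

/-- The universal automaton. -/
def universal : SCA UState Bool where
  V := {-2, -1, 0, 1, 2}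
  V' := {0}
  f := fun q r => .next (q ⟨-2, by simp⟩) (q ⟨-1, by simp⟩) (q ⟨0, by simp⟩) (q ⟨1, by simp⟩)
    (q ⟨2, by simp⟩) (r ⟨0, by simp⟩)

theorem universal_F (c : ℤ → UState) (s : ℤ → Bool) (p : ℤ) :
    universal.F c s p = .next (c (p - 2)) (c (p - 1)) (c p) (c (p + 1)) (c (p + 2)) (s p) := by
  simp [universal, F, sub_eq_add_neg]

end Universal

section Track

variable {h : ℕ}

/-- Content at time `τ` of an initially empty track moving to the right at speed two, on which
`o τ z` is written in step `τ` at the position `2 * h * z`. -/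
def track (h : ℕ) (o : ℕ → ℤ → Bool) : ℕ → ℤ → Bool
  | 0, _ => false
  | τ + 1, p => if p % (2 * h) = 0 then o τ (p / (2 * h)) else track h o τ (p - 2)

theorem mul_add_ediv_emod {z x : ℤ} (hx : 0 ≤ x) (hxh : x < 2 * h) :
    (2 * h * z + x) / (2 * h) = z ∧ (2 * h * z + x) % (2 * h) = x :=
  (Int.ediv_emod_unique (by omega)).2 ⟨add_comm _ _, hx, hxh⟩

theorem exists_eq_mul_add (hh : 0 < h) (p : ℤ) :
    ∃ z x : ℤ, 0 ≤ x ∧ x < 2 * h ∧ p = 2 * h * z + x :=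
  ⟨p / (2 * h), p % (2 * h), Int.emod_nonneg _ (by omega), Int.emod_lt_of_pos _ (by omega),
    (Int.mul_ediv_add_emod _ _).symm⟩

theorem track_mul_add_two_mul (o : ℕ → ℤ → Bool) (τ : ℕ) (z : ℤ) {i : ℕ} (hi : i < h) :
    track h o τ (2 * h * z + 2 * i) = if i < τ then o (τ - 1 - i) z else false := by
  induction i generalizing τ with
  | zero =>
    obtain ⟨hz, hx⟩ := mul_add_ediv_emod (h := h) (z := z) (x := 2 * (0 : ℕ)) (by simp) (by omega)
    cases τ with
    | zero => rfl
    | succ τ => rw [track, hx, hz]; simp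
  | succ i ih =>
    have hx := (mul_add_ediv_emod (h := h) (z := z) (x := 2 * (i + 1 : ℕ)) (by omega) (by omega)).2
    cases τ with
    | zero => rfl
    | succ τ =>
      have hp : (2 * h * z + 2 * (i + 1 : ℕ) - 2 : ℤ) = 2 * h * z + 2 * i := by push_cast; ring
      rw [track, hx, if_neg (by omega), hp, ih _ (by omega)]
      simp [Nat.sub_sub, add_comm]

theorem track_two_mul_add_one (o : ℕ → ℤ → Bool) (τ : ℕ) (q : ℤ) :
    track h o τ (2 * q + 1) = false := by
  induction τ generalizing q with
  | zero => rfl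
  | succ τ ih =>
    have hmod : (2 * q + 1) % (2 * h : ℤ) ≠ 0 := fun e => by
      have := (Dvd.intro (h : ℤ) rfl).trans (Int.dvd_of_emod_eq_zero e)
      omega
    have hq : 2 * q + 1 - 2 = 2 * (q - 1) + 1 := by ring
    rw [track, if_neg hmod, hq, ih]

theorem track_mul_sub_two (hh : 0 < h) (o : ℕ → ℤ → Bool) (τ : ℕ) (z : ℤ) :
    track h o τ (2 * h * z - 2) = if h ≤ τ then o (τ - h) (z - 1) else false := by
  obtain ⟨i, rfl⟩ := Nat.exists_eq_add_of_le' hh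
  have hp : (2 * (i + 1 : ℕ) * z - 2 : ℤ) = 2 * (i + 1 : ℕ) * (z - 1) + 2 * i := by push_cast; ring
  rw [hp, track_mul_add_two_mul o τ _ (by omega)]
  simp [Nat.sub_sub, add_comm]

theorem track_two_mul (hh : 0 < h) {o : ℕ → ℤ → Bool} (ho : ∀ k z, h ≤ k → o k z = false) (p : ℤ) :
    track h o (2 * h) p = false := by
  obtain ⟨q, rfl | rfl⟩ := Int.even_or_odd' p
  · obtain ⟨z, i, hi, rfl⟩ : ∃ (z : ℤ) (i : ℕ), i < h ∧ q = h * z + i :=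
      ⟨q / h, (q % h).toNat, by
        have := Int.emod_lt_of_pos q (b := h) (by omega)
        omega, by
        rw [Int.toNat_of_nonneg (Int.emod_nonneg _ (by omega)), Int.mul_ediv_add_emod]⟩
    rw [mul_add, ← mul_assoc, track_mul_add_two_mul _ _ _ hi, if_pos (by omega), ho _ _ (by omega)]
  · exact track_two_mul_add_one o _ q

end Track

section Config

variable (w h : ℕ) (P : ℕ → Instr) (o : ℕ → ℤ → Bool)

/-- The configuration at time `τ` in which the state of the head of the block `z` is `σ z`, if all
blocks have length `2 * h`, run the program `P` and have sent the messages `o`. At time `τ` the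
position `τ` of the data loop is in front of the head. -/
def config (τ : ℕ) (σ : ℤ → Loop (2 * w)) (p : ℤ) : UState where
  prog := P ((p + τ) % (2 * h)).toNat
  head := p % (2 * h) = 0
  zone := p % (2 * h) < w
  wall := p % (2 * h) = w - 1
  acc := if p % (2 * h) = 0 then (σ (p / (2 * h))).1 else false
  up := if p % (2 * h) < w then (σ (p / (2 * h))).2 (τ - 1 - p % (2 * h) : ℤ) else blank
  down := if p % (2 * h) < w then (σ (p / (2 * h))).2 (τ + p % (2 * h) : ℤ) else blank
  msgL := track h (fun k z => o k (-z)) τ (-p)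
  msgR := track h o τ p

/-- What the head of the block `z` receives in step `τ` from the messages `o`, sent by all blocks,
and the random bits `s`. -/
def received (s : ℤ → Bool) (τ : ℕ) (z : ℤ) : Signal where
  left := if h ≤ τ then o (τ - h) (z - 1) else false
  right := if h ≤ τ then o (τ - h) (z + 1) else false
  random := s (2 * h * z)

variable {w h}

theorem config_up {τ : ℕ} (σ : ℤ → Loop (2 * w)) (z : ℤ) {x : ℤ} (hx : 0 ≤ x) (hxw : x < w)
    (hwh : w ≤ 2 * h) :
    (config w h P o τ σ (2 * h * z + x)).up = (σ z).2 (τ - 1 - x : ℤ) := by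
  obtain ⟨hdiv, hmod⟩ := mul_add_ediv_emod (h := h) (z := z) hx (by omega)
  simp only [config, hdiv, hmod, hxw, if_true]

theorem config_down {τ : ℕ} (σ : ℤ → Loop (2 * w)) (z : ℤ) {x : ℤ} (hx : 0 ≤ x) (hxw : x < w)
    (hwh : w ≤ 2 * h) :
    (config w h P o τ σ (2 * h * z + x)).down = (σ z).2 (τ + x : ℤ) := by
  obtain ⟨hdiv, hmod⟩ := mul_add_ediv_emod (h := h) (z := z) hx (by omega)
  simp only [config, hdiv, hmod, hxw, if_true]

theorem config_head (hw : 0 < w) {τ : ℕ} (hτ : τ < 2 * h) (σ : ℤ → Loop (2 * w)) (s : ℤ → Bool)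
    (z : ℤ) :
    (config w h P o τ σ (2 * h * z)).prog (config w h P o τ σ (2 * h * z)).acc
      (config w h P o τ σ (2 * h * z)).down
      ⟨(config w h P o τ σ (2 * h * z - 2)).msgR, (config w h P o τ σ (2 * h * z + 2)).msgL,
        s (2 * h * z)⟩ =
      P τ (σ z).1 ((σ z).2 τ) (received h o s τ z) := by
  have hh : 0 < h := by omega
  have hprog : (τ % (2 * h) : ℤ).toNat = τ := by
    rw [Int.emod_eq_of_lt (by omega) (by omega), Int.toNat_natCast]
  have hright : -(2 * h * z + 2 : ℤ) = 2 * h * (-z) - 2 := by ring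
  have hneighbour : -(-z - 1) = z + 1 := by ring
  have hdiv : (2 * h * z : ℤ) / (2 * h) = z := Int.mul_ediv_cancel_left _ (by omega)
  simp only [config, received, hright, track_mul_sub_two hh, hneighbour, hdiv, hw, hprog,
    Int.mul_emod_right, Int.mul_add_emod_self_left, if_true, Nat.cast_pos, add_zero,
    Int.cast_natCast]

theorem Loop.step_apply_of_ne (σ : Loop (2 * w)) (I : Instr) (i : Signal) {τ : ℕ} {k : ℤ}
    (hk : k ≠ τ) (hkw : (k - τ).natAbs ≤ w) : (σ.step I τ i).2 k = σ.2 k := by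
  refine Function.update_of_ne (fun hcast => hk (sub_eq_zero.1 ?_)) ..
  rw [← Int.cast_natCast, eq_comm, ZMod.intCast_eq_intCast_iff_dvd_sub] at hcast
  exact Int.eq_zero_of_dvd_of_natAbs_lt_natAbs hcast (by omega)

variable {o} {P} {τ : ℕ} {σ : ℤ → Loop (2 * w)} {s : ℤ → Bool}

theorem down_universal_F_config (hwh : w ≤ 2 * h) (I : Instr) (i : ℤ → Signal) (z : ℤ) {x : ℤ}
    (hx : 0 ≤ x) (hxh : x < 2 * h) :
    (universal.F (config w h P o τ σ) s (2 * h * z + x)).down =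
      (config w h P o (τ + 1) (fun z => (σ z).step I τ (i z)) (2 * h * z + x)).down := by
  have hmod := (mul_add_ediv_emod (z := z) hx hxh).2
  rw [universal_F, UState.next]
  dsimp only
  by_cases hxw : x < w
  · rw [config_down _ _ _ _ hx hxw hwh, Loop.step_apply_of_ne _ _ _ (by omega) (by omega)]
    by_cases hx' : x = w - 1
    · have hwall : (config w h P o τ σ (2 * h * z + x)).wall = true := by simp [config, hmod, ← hx']
      have hturn : (τ - 1 - x : ℤ) = (τ + 1 : ℕ) + x - (2 * w : ℕ) := by push_cast; omega
      rw [hwall, if_pos rfl, config_up _ _ _ _ hx hxw hwh, hturn, Int.cast_sub, Int.cast_natCast,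
        ZMod.natCast_self, sub_zero]
    · have hcell : (config w h P o τ σ (2 * h * z + x)).wall = false ∧
          (config w h P o τ σ (2 * h * z + x)).zone = true := by simp [config, hmod, hxw, hx']
      have hindex : (τ + (x + 1) : ℤ) = (τ + 1 : ℕ) + x := by push_cast; ring
      rw [hcell.1, hcell.2, if_neg Bool.false_ne_true, if_pos rfl, add_assoc,
        config_down _ _ _ _ (by omega) (by omega) hwh, hindex]
  · have hwall : x ≠ w - 1 := by omega
    simp [config, hmod, hxw, hwall]

theorem universal_F_config_head (hw : 0 < w) (hwh : w ≤ 2 * h) (hτ : τ < 2 * h)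
    (ho : ∀ z, (σ z).message (P τ) τ (received h o s τ z) = o τ z) (z : ℤ) :
    universal.F (config w h P o τ σ) s (2 * h * z) =
      config w h P o (τ + 1) (fun z => (σ z).step (P τ) τ (received h o s τ z)) (2 * h * z) := by
  have hdiv : (2 * h * z : ℤ) / (2 * h) = z := Int.mul_ediv_cancel_left _ (by omega)
  have hdiv' : (-(2 * h * z) : ℤ) / (2 * h) = -z := by
    rw [← mul_neg, Int.mul_ediv_cancel_left _ (by omega)]
  have hhead : (config w h P o τ σ (2 * h * z)).head = true := by simp [config]
  have hF := universal_F (config w h P o τ σ) s (2 * h * z)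
  rw [UState.next, config_head P o hw hτ, hhead] at hF
  ext1
  case down =>
    simpa only [add_zero] using down_universal_F_config hwh _ _ z le_rfl (by omega)
  all_goals rw [hF]
  case prog => simp only [config, Nat.cast_add_one, add_assoc, add_comm (1 : ℤ)]
  case head => exact hhead.symm
  case zone | wall => rfl
  case acc => simp [config, hdiv, Loop.step]
  case up => simp [config, hdiv, Loop.step, hw]
  case msgL => simpa [config, track, hdiv', Loop.message] using ho z
  case msgR => simpa [config, track, hdiv, Loop.message] using ho z

theorem universal_F_config_of_pos (hwh : w ≤ 2 * h) (I : Instr) (i : ℤ → Signal) (z : ℤ) {x : ℤ}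
    (hx : 0 < x) (hxh : x < 2 * h) :
    universal.F (config w h P o τ σ) s (2 * h * z + x) =
      config w h P o (τ + 1) (fun z => (σ z).step I τ (i z)) (2 * h * z + x) := by
  have hmod := (mul_add_ediv_emod (z := z) hx.le hxh).2
  have hmod' : -(2 * h * z + x) % (2 * h : ℤ) ≠ 0 := by
    rw [Ne, ← Int.dvd_iff_emod_eq_zero, dvd_neg, Int.dvd_iff_emod_eq_zero, hmod]
    exact hx.ne'
  have hhead : (config w h P o τ σ (2 * h * z + x)).head = false := by simp [config, hmod, hx.ne']
  have hF := universal_F (config w h P o τ σ) s (2 * h * z + x)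
  rw [UState.next, hhead] at hF
  ext1
  case down => exact down_universal_F_config hwh _ _ z hx.le hxh
  all_goals rw [hF]
  case prog => simp only [config, Nat.cast_add_one, add_assoc, add_comm (1 : ℤ)]
  case head => exact hhead.symm
  case zone | wall => rfl
  case acc => simp [config, hmod, hx.ne']
  case up =>
    by_cases hxw : x < w
    · have hzone : (config w h P o τ σ (2 * h * z + x)).zone = true := by simp [config, hmod, hxw]
      have hindex : (τ - 1 - (x - 1) : ℤ) = (τ + 1 : ℕ) - 1 - x := by push_cast; ring
      dsimp only
      rw [config_up _ _ _ _ hx.le hxw hwh, Loop.step_apply_of_ne _ _ _ (by omega) (by omega),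
        hzone, if_neg Bool.false_ne_true, if_pos rfl, add_sub_assoc,
        config_up _ _ _ _ (by omega) (by omega) hwh, hindex]
    · simp [config, hmod, hxw]
  case msgL =>
    simp only [config, track, if_neg hmod', Bool.false_eq_true, if_false, neg_add' _ (2 : ℤ)]
  case msgR => simp [config, track, hmod, hx.ne']

theorem universal_F_config (hw : 0 < w) (hwh : w ≤ 2 * h) (hτ : τ < 2 * h)
    (ho : ∀ z, (σ z).message (P τ) τ (received h o s τ z) = o τ z) :
    universal.F (config w h P o τ σ) s =
      config w h P o (τ + 1) fun z => (σ z).step (P τ) τ (received h o s τ z) := by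
  funext p
  obtain ⟨z, x, hx, hxh, rfl⟩ := exists_eq_mul_add (by omega : 0 < h) p
  obtain rfl | hx := hx.eq_or_lt
  · simpa only [add_zero] using universal_F_config_head hw hwh hτ ho z
  · exact universal_F_config_of_pos hwh _ _ z hx hxh

theorem orbit_config (hw : 0 < w) (hwh : w ≤ 2 * h) {S : ℕ → ℤ → Bool} {inp : ℤ → ℕ → Signal}
    (hinp : ∀ z τ, inp z τ = received h o (S τ) τ z)
    (ho : ∀ z τ, (run P (inp z) (σ z) τ).message (P τ) τ (inp z τ) = o τ z) {m : ℕ}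
    (hm : m ≤ 2 * h) :
    universal.orbit (config w h P o 0 σ) S m =
      config w h P o m fun z => run P (inp z) (σ z) m := by
  induction m with
  | zero => rfl
  | succ m ih =>
    rw [orbit_succ, ih (by omega),
      universal_F_config hw hwh (by omega) fun z => by rw [← hinp, ho]]
    simp only [run, hinp]

theorem config_two_mul (hh : 0 < h) (hwh : w ∣ h) (ho : ∀ k z, h ≤ k → o k z = false)
    (σ : ℤ → Loop (2 * w)) : config w h P o (2 * h) σ = config w h P o 0 σ := by
  have hcast : (((2 * h : ℕ) : ℤ) : ZMod (2 * w)) = ((0 : ℕ) : ℤ) := by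
    rw [Int.cast_natCast, (ZMod.natCast_eq_zero_iff _ _).2 (Nat.mul_dvd_mul_left 2 hwh)]
    simp
  have hprog (p : ℤ) : (p + (2 * h : ℕ)) % (2 * h : ℤ) = (p + (0 : ℕ)) % (2 * h) := by simp
  funext p
  simp only [config, Int.cast_sub, Int.cast_add, hcast, hprog, track_two_mul hh ho,
    track_two_mul hh fun k z hk => ho k (-z) hk, track]

end Config

section Blocks

variable {w : ℕ} [NeZero w]

/-- Half of the length of the blocks that evaluate `f`. -/
noncomputable def halfLength (f : (ZMod (2 * w) → Input) → Word (2 * w)) : ℕ :=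
  2 * w * ((evaluation f).length + 1)

/-- The configuration whose blocks evaluate `f` and contain the words `x`. -/
noncomputable def blocks (f : (ZMod (2 * w) → Input) → Word (2 * w)) (x : ℤ → Word (2 * w)) :
    ℤ → UState :=
  config w (halfLength f) (program (transducer f)) (fun _ _ => false) 0
    fun z => (false, load (x z))

theorem two_mul_halfLength (f : (ZMod (2 * w) → Input) → Word (2 * w)) :
    2 * halfLength f = 2 * w * (transducer f).length := by
  simp only [halfLength, transducer, List.length_cons, List.length_append, List.length_replicate]
  ring

theorem unpack_blocks {T : Type*} {f : (ZMod (2 * w) → Input) → Word (2 * w)} {m : ℕ+}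
    (hm : (m : ℕ) = 2 * halfLength f) (x : T → Word (2 * w)) (c : ℤ → T) :
    unpack m ((fun t (j : Fin m) => blocks f (fun _ => x t) j) ∘ c) = blocks f (x ∘ c) := by
  funext p
  have hm' : (m : ℤ) = 2 * halfLength f := by exact_mod_cast hm
  have := Int.emod_nonneg p (b := m) (by have := m.pos; omega)
  simp only [unpack, blocks, config, Function.comp_apply, Int.toNat_of_nonneg this]
  rw [hm']
  simp [track]

theorem le_halfLength (f : (ZMod (2 * w) → Input) → Word (2 * w)) : 2 * w ≤ halfLength f :=
  Nat.le_mul_of_pos_right _ (by omega)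

theorem blocks_down (f : (ZMod (2 * w) → Input) → Word (2 * w)) (x : ℤ → Word (2 * w)) {p : ℤ}
    (hp : 0 ≤ p) (hpw : p < w) : (blocks f x p).down = load (x 0) p := by
  have hw := le_halfLength f
  simpa [blocks] using config_down (h := halfLength f) (program (transducer f)) (fun _ _ => false)
    (τ := 0) (fun z => (false, load (x z))) 0 hp hpw (by omega)

theorem blocks_up (f : (ZMod (2 * w) → Input) → Word (2 * w)) (x : ℤ → Word (2 * w)) {p : ℤ}
    (hp : 0 ≤ p) (hpw : p < w) : (blocks f x p).up = load (x 0) (-1 - p : ℤ) := by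
  have hw := le_halfLength f
  simpa [blocks] using config_up (h := halfLength f) (program (transducer f)) (fun _ _ => false)
    (τ := 0) (fun z => (false, load (x z))) 0 hp hpw (by omega)

theorem load_injective {n : ℕ} : Function.Injective (load : Word n → ZMod n → Datum) :=
  fun _ _ h => funext fun k => congrArg (fun d => d.toInput.own) (congrFun h k)

theorem blocks_injective {f : (ZMod (2 * w) → Input) → Word (2 * w)} {m : ℕ}
    (hm : m = 2 * halfLength f) :
    Function.Injective fun (x : Word (2 * w)) (j : Fin m) => blocks f (fun _ => x) j := by
  have hw := le_halfLength f
  refine fun x y hxy => load_injective (funext fun k => ?_)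
  have hcell (j : ℕ) (hj : j < w) : blocks f (fun _ => x) j = blocks f (fun _ => y) j :=
    congrFun hxy ⟨j, by omega⟩
  have hk := ZMod.val_lt k
  obtain hkw | hkw := lt_or_ge k.val w
  · have hdown := congrArg UState.down (hcell k.val hkw)
    rwa [blocks_down _ _ (by omega) (by omega), blocks_down _ _ (by omega) (by omega),
      Int.cast_natCast, ZMod.natCast_zmod_val] at hdown
  · have hindex : (-1 - (2 * w - 1 - k.val : ℕ) : ℤ) = k.val - (2 * w : ℕ) := by omega
    have hup := congrArg UState.up (hcell (2 * w - 1 - k.val) (by omega))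
    rwa [blocks_up _ _ (by omega) (by omega), blocks_up _ _ (by omega) (by omega), hindex,
      Int.cast_sub, Int.cast_natCast, Int.cast_natCast, ZMod.natCast_self, sub_zero,
      ZMod.natCast_zmod_val] at hup

theorem orbit_blocks (f : (ZMod (2 * w) → Input) → Word (2 * w)) (x : ℤ → Word (2 * w))
    (S : ℕ → ℤ → Bool) :
    universal.orbit (blocks f x) S (2 * halfLength f) = blocks f fun z =>
      f fun k => ⟨x z k, S k.val (2 * halfLength f * z), x (z - 1) k, x (z + 1) k⟩ := by
  have hw := le_halfLength f
  have hpos := NeZero.pos w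
  have hdvd : w ∣ halfLength f := (Nat.dvd_mul_left w 2).trans (Nat.dvd_mul_right _ _)
  let o : ℕ → ℤ → Bool := fun τ z => sent (x z) τ
  let inp (z : ℤ) (τ : ℕ) : Signal := received (halfLength f) o (S τ) τ z
  have ho (k : ℕ) (z : ℤ) (hk : halfLength f ≤ k) : o k z = false := if_neg (by omega)
  have hrun (z : ℤ) : run (program (transducer f)) (inp z) (false, load (x z)) (2 * halfLength f) =
      (false, load (f fun k =>
        ⟨x z k, S k.val (2 * halfLength f * z), x (z - 1) k, x (z + 1) k⟩)) := by
    rw [two_mul_halfLength, run_program, exec_transducer]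
    congr 3
    funext k
    simp [gathered, inp, received, o, sent, halfLength, ZMod.val_lt]
  calc universal.orbit (blocks f x) S (2 * halfLength f)
    _ = config w _ _ o (2 * halfLength f) fun z => run _ (inp z) (false, load (x z)) _ :=
      orbit_config hpos (by omega) (fun _ _ => rfl)
        (fun z => message_transducer (inp z) f (x z)) le_rfl
    _ = config w _ _ o 0 _ := config_two_mul (by omega) hdvd ho _
    _ = blocks f _ := congrArg (config w _ _ o 0) (funext hrun)

end Blocks

section Universality

theorem exists_injective_word (X : Type*) [Finite X] [Nonempty X] :
    ∃ (w : ℕ) (_ : NeZero w) (code : X → Word (2 * w)), Function.Injective code := by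
  have hpos : 0 < Nat.card X := Nat.card_pos
  refine ⟨Nat.card X, ⟨hpos.ne'⟩, fun x k => k.val = Finite.equivFin X x, fun x y hxy => ?_⟩
  have hx := (Finite.equivFin X x).2
  have hval : ((Finite.equivFin X x : ℕ) : ZMod (2 * Nat.card X)).val = Finite.equivFin X x :=
    ZMod.val_cast_of_lt (by omega)
  have := congrFun hxy (Finite.equivFin X x : ℕ)
  simpa [hval, Fin.val_inj] using this

variable {T R : Type*} [Finite T] [Nonempty T] [Finite R] [Nonempty R]

theorem exists_simulates_nearest (g : T → T → T → R → T) :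
    ∃ (m : ℕ+) (i : T → Fin m → UState), Function.Injective i ∧
      universal.Simulates m (fun c => unpack m (i ∘ c)) (nearest g) := by
  obtain ⟨w, _, code, hcode⟩ := exists_injective_word (T ⊕ R)
  let word : T → Word (2 * w) := code ∘ .inl
  have hword : Function.Injective word := hcode.comp Sum.inl_injective
  let state : Word (2 * w) → T := Function.invFun word
  have hstate : Function.LeftInverse state word := Function.leftInverse_invFun hword
  let symbol : Word (2 * w) → R := Function.invFun (code ∘ .inr)
  have hsymbol : Function.Surjective symbol :=
    Function.invFun_surjective (hcode.comp Sum.inr_injective)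
  let f (u : ZMod (2 * w) → Input) : Word (2 * w) :=
    word (g (state fun k => (u k).left) (state fun k => (u k).own) (state fun k => (u k).right)
      (symbol fun k => (u k).random))
  have hhalf : 0 < halfLength f := (NeZero.pos (2 * w)).trans_le (le_halfLength f)
  let m : ℕ+ := ⟨2 * halfLength f, by omega⟩
  refine ⟨m, fun t j => blocks f (fun _ => word t) j, (blocks_injective rfl).comp hword, ?_⟩
  refine .of_orbit (fun S z => symbol fun k => S k.val (2 * halfLength f * z)) (fun r => ?_) ?_
  · choose v hv using fun z => hsymbol (r z)
    refine ⟨fun τ p => v (p / (2 * halfLength f)) τ, funext fun z => ?_⟩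
    have hdiv : (2 * halfLength f * z : ℤ) / (2 * halfLength f) = z :=
      Int.mul_ediv_cancel_left _ (by omega)
    simp only [hdiv, ZMod.natCast_zmod_val, hv]
  · intro c S
    rw [unpack_blocks rfl, unpack_blocks rfl]
    refine (orbit_blocks f _ S).trans ?_
    congr 1
    funext z
    simp only [f, Function.comp_apply, hstate _, nearest_F]

theorem exists_nSub_universal (A : SCA T R) : ∃ m t : ℕ+, NSub A (universal.rescale m t 0) := by
  obtain ⟨m, i, hi, h⟩ := exists_simulates_nearest A.gatherStep
  exact ⟨m, m * (A.radius + 1).succPNat,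
    (h.trans (simulates_gather A)).nSub_rescale (hi.comp (gatherInit_injective _))⟩

end Universality

end SCA

theorem theorem5 :
    ∃ (QU RU : Type) (_ : Finite QU) (_ : Nonempty QU) (_ : Finite RU) (_ : Nonempty RU)
      (U : SCA QU RU), U.IsPCA ∧
      ∀ (Q : Type*) (R : Type*) [Finite Q] [Nonempty Q] [Finite R] [Nonempty R] (A : SCA Q R),
        SCA.NSimInj A U ∧ SCA.NSimMix A U ∧
        -- block simulation, without rescaling of `A` and without translation
        ∃ m t : ℕ+, SCA.NSub A (U.rescale m t 0) := by
  refine ⟨SCA.UState, Bool, inferInstance, inferInstance, inferInstance, inferInstance,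
    SCA.universal, rfl, fun Q R _ _ _ _ A => ?_⟩
  obtain ⟨m, t, h⟩ := SCA.exists_nSub_universal (A.rescale 1 1 0)
  exact ⟨⟨1, m, 1, t, 0, 0, h⟩, ⟨1, m, 1, t, 0, 0, h.nMix⟩, SCA.exists_nSub_universal A⟩
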